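/- Let $m\ge 1$ and $n\ge 1$. Consider a random utility model $\mathcal M$ (location family) over alternatives $a_1,\dots,a_m$: given $\vec\theta=(\theta_1,\dots,\theta_m)$, the utilities $u_1,\dots,u_m$ are independent and $u_i$ has density $x\mapsto\pi_i(x-\theta_i)$, where each $\pi_i$ is a probability density on $\mathbb R$ that is continuous and positive everywhere. Put $p_{ij}(\vec\theta)=\Pr(u_i>u_j\mid\vec\theta)=\int_{-\infty}^{\infty}\int_{y}^{\infty}\pi_i(x-\theta_i)\,\pi_j(y-\theta_j)\,dx\,dy$. As rankings depend only on differences of the $\theta_i$, the parameter space is $\Theta=\{\vec\theta\in\mathbb R^m:\theta_m=0\}$. Let $P=(R_1,\dots,R_n)$ be a profile of $n$ rankings (linear orders) of the alternatives, let $\mathcal G=\{g_{kl}\ge 0: 1\le k<l\le m\}$ be a weighted rank-breaking (weights on pairs of positions), and let $\mathcal W=\{w_{ij}\ge 0: i\ne j\}$ be weights on ordered pairs of alternatives. For $i\neq j$ let $\kappa_{ij}=\frac1n\sum_{t=1}^n \mathcal G_{ij}(R_t)$, where $\mathcal G_{ij}(R)=g_{kl}$ if $a_i$ and $a_j$ are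 at positions $k<l$ of $R$, and $\mathcal G_{ij}(R)=0$ if $R$ ranks $a_i$ below $a_j$. The composite likelihood is $$\mathrm{CL}(\vec\theta,P)=\prod_{i\ne j}p_{ij}(\vec\theta)^{\kappa_{ij}w_{ij}},\qquad \vec\theta\in\Theta .$$ Let $\mathcal W\otimes G(P)$ be the weighted directed graph on $\{1,\dots,m\}$ with weight $w_{ij}\kappa_{ij}$ from $i$ to $j$ for $i\ne j$, in which $(i,j)$ counts as an edge when this weight is positive. It is weakly connected if the graph obtained by forgetting directions is connected, and strongly connected if there is a directed path of edges from every vertex to every other vertex. A positive function $f$ on a convex set is strictly log-concave if $f(\lambda x+(1-\lambda)y)>f(x)^\lambda f(y)^{1-\lambda}$ for all $x\ne y$ and $0<\lambda<1$. (1) If every density $\pi_i$ is strictly log-concave on $\mathbb R$, then $\mathrm{CL}(\cdot,P)$ is strictly log-concave on $\Theta$ if and only if $\mathcal W\otimes G(P)$ is weakly connected. (2) $\mathrm{CL}(\cdot,P)$ attains its maximum on $\Theta$ and the set $\arg\max_{\vec\theta\in\Theta}\mathrm{CL}(\vec\theta,P)$ is bounded if and only if $\mathcal W\otimes G(P)$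 is strongly connected. (Here log-concavity of the $\pi_i$ is not assumed.) -/

import Mathlib

namespace RBCML

/-- A positive function `f` is strictly log-concave on the convex set `s`. -/
def StrictLogConcaveOn {E : Type*} [AddCommGroup E] [Module ℝ E] (s : Set E) (f : E → ℝ) : Prop :=
  Convex ℝ s ∧ (∀ x ∈ s, 0 < f x) ∧
    ∀ x ∈ s, ∀ y ∈ s, x ≠ y → ∀ c : ℝ, 0 < c → c < 1 →
      f x ^ c * f y ^ (1 - c) < f (c • x + (1 - c) • y)

/-- A random utility model (location family) over `m` alternatives. Given the parameter `θ`, the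
utilities are independent and the utility of alternative `i` has density `x ↦ pdf i (x - θ i)`. The
densities are continuous and positive everywhere. -/
structure RUM (m : ℕ) where
  pdf : Fin m → ℝ → ℝ
  continuous_pdf : ∀ i, Continuous (pdf i)
  pdf_pos : ∀ i x, 0 < pdf i x
  integrable_pdf : ∀ i, MeasureTheory.Integrable (pdf i)
  integral_pdf : ∀ i, ∫ x, pdf i x = 1

/-- The probability that `i` is preferred to `j` (its utility `x` exceeds the utility `y` of `j`),
when the parameter is `θ`. -/
noncomputable def RUM.pairProb {m : ℕ} (M : RUM m) (i j : Fin m) (θ : Fin m → ℝ) : ℝ :=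
  ∫ y : ℝ, ∫ x in Set.Ioi y, M.pdf i (x - θ i) * M.pdf j (y - θ j)

/-- A ranking (linear order) of the `m` alternatives: `R a` is the position of the alternative `a`,
where position `0` is the top. -/
abbrev Ranking (m : ℕ) := Fin m ≃ Fin m

/-- A preference profile of `n` rankings. -/
abbrev Profile (m n : ℕ) := Fin n → Ranking m

/-- A weighted rank-breaking: nonnegative weights on the unordered pairs of positions. The pair
`{k, l}` with `k < l` has weight `weight k l`; the other values of `weight` are never used. -/
structure Breaking (m : ℕ) where
  weight : Fin m → Fin m → ℝ
  nonneg : ∀ k l, k < l → 0 ≤ weight k l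

/-- A CML-weight vector: nonnegative weights on the ordered pairs of distinct alternatives. -/
structure CMLWeight (m : ℕ) where
  weight : Fin m → Fin m → ℝ
  nonneg : ∀ i j, i ≠ j → 0 ≤ weight i j

/-- The weight that the breaking gives to the comparison "`a` above `b`" in the ranking `R`: the
weight of the pair of positions of `a` and `b` if `R` ranks `a` above `b`, and `0` otherwise. -/
def Breaking.comparison {m : ℕ} (G : Breaking m) (R : Ranking m) (a b : Fin m) : ℝ :=
  if R a < R b then G.weight (R a) (R b) else 0

/-- The average weight `κ a b` of the comparison "`a` above `b`" over the profile. -/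
noncomputable def kappa {m n : ℕ} (G : Breaking m) (P : Profile m n) (a b : Fin m) : ℝ :=
  (∑ j, G.comparison (P j) a b) / n

/-- A weighted directed graph on `V`, given by the weights of its edges; a pair of distinct vertices
is an edge when its weight is positive. -/
abbrev WDigraph (V : Type*) := V → V → ℝ

/-- The product of two weighted graphs: the weights are multiplied edge by edge. -/
def WDigraph.mul {V : Type*} (A B : WDigraph V) : WDigraph V := fun i j => A i j * B i j

/-- The graph with the directions of the edges removed is connected. -/
def WDigraph.WeaklyConnected {V : Type*} (A : WDigraph V) : Prop :=
  (SimpleGraph.fromRel fun i j => 0 < A i j).Connected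

/-- Between any two vertices there is a directed path with positive weights. -/
def WDigraph.StronglyConnected {V : Type*} (A : WDigraph V) : Prop :=
  ∀ i j, Relation.ReflTransGen (fun a b => 0 < A a b) i j

/-- The weighted directed graph `W ⊗ G(P)`, where `G(P)` is the graph with weights `κ`. -/
noncomputable def weightedGraph {m n : ℕ} (G : Breaking m) (W : CMLWeight m) (P : Profile m n) :
    WDigraph (Fin m) :=
  WDigraph.mul W.weight (kappa G P)

/-- The composite marginal likelihood
`CL(θ, P) = ∏_{i ≠ j} p_{ij}(θ) ^ (κ_{ij} w_{ij})`. -/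
noncomputable def compositeLikelihood {m n : ℕ} (M : RUM m) (G : Breaking m) (W : CMLWeight m)
    (P : Profile m n) (θ : Fin m → ℝ) : ℝ :=
  ∏ e ∈ (Finset.univ : Finset (Fin m)).offDiag,
    M.pairProb e.1 e.2 θ ^ (kappa G P e.1 e.2 * W.weight e.1 e.2)

/-- The parameter space for `k + 1` alternatives: the parameter of the last one is `0`. -/
def paramSpace (k : ℕ) : Set (Fin (k + 1) → ℝ) := {θ | θ (Fin.last k) = 0}

/-- The set of maximizers of `f` over `s`. -/
def argmaxOn {E : Type*} (s : Set E) (f : E → ℝ) : Set E := {x | x ∈ s ∧ IsMaxOn f s x}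

end RBCML

open MeasureTheory Set Filter Topology

namespace RBCML

/-! ### Strict log-concavity -/

/-! Each `p_ij` is a function `exceedProb` of `θ i - θ j` alone: continuous, nondecreasing, with
values in `(0, 1]`, and tending to `0` at `-∞`. Everything else is about differences along edges.

(1) For strictly log-concave densities, `exceedProb` is strictly log-concave: the upper tail
inherits the property, and a Cauchy-Binet inequality passes it to the convolution-type integral. So
the likelihood is strictly log-concave between `x` and `y` unless `x - y` is constant along every
edge; weak connectivity and the normalization then force `x = y`. If the graph is disconnected,
shifting one component leaves the likelihood unchanged.

(2) All factors are at most `1`, so a positive lower bound on the likelihood bounds every edge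
difference from below. Directed paths to and from the last vertex then bound all coordinates, and
superlevel sets are compact. If `b` is unreachable from `a`, raising the vertices unreachable from
`a` relative to the others decreases no edge difference, so any maximizer starts a ray of
maximizers. -/

theorem strictLogConcaveOn_of_strictConcaveOn_log {E : Type*} [AddCommGroup E] [Module ℝ E]
    {s : Set E} {f : E → ℝ} (hpos : ∀ x ∈ s, 0 < f x)
    (hf : StrictConcaveOn ℝ s fun x => Real.log (f x)) : StrictLogConcaveOn s f := by
  refine ⟨hf.1, hpos, fun x hx y hy hxy c hc hc1 => ?_⟩
  have hc' : 0 < 1 - c := by linarith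
  have h := hf.2 hx hy hxy hc hc' (by ring)
  have hz := hpos _ (hf.1 hx hy hc.le hc'.le (by ring))
  rw [Real.rpow_def_of_pos (hpos x hx), Real.rpow_def_of_pos (hpos y hy), ← Real.exp_add,
    ← Real.lt_log_iff_exp_lt hz]
  simpa [mul_comm] using h

theorem StrictLogConcaveOn.pos {f : ℝ → ℝ} (hf : StrictLogConcaveOn univ f) (x : ℝ) : 0 < f x :=
  hf.2.1 x (mem_univ x)

theorem StrictLogConcaveOn.le {f : ℝ → ℝ} (hf : StrictLogConcaveOn univ f) (x y : ℝ) {c : ℝ}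
    (hc : 0 < c) (hc1 : c < 1) : f x ^ c * f y ^ (1 - c) ≤ f (c • x + (1 - c) • y) := by
  rcases eq_or_ne x y with rfl | hxy
  · rw [← Real.rpow_add (hf.pos x), ← add_smul]
    simp
  · exact (hf.2.2 x (mem_univ x) y (mem_univ y) hxy c hc hc1).le

/-- A strictly log-concave function has strictly decreasing ratios `f (x + d) / f x`. -/
theorem StrictLogConcaveOn.mul_lt_mul {f : ℝ → ℝ} (hf : StrictLogConcaveOn univ f) {p q d : ℝ}
    (hpq : p < q) (hd : 0 < d) : f p * f (q + d) < f (p + d) * f q := by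
  have hL : 0 < q + d - p := by linarith
  -- With this `t`, `p + d` and `q` are the two complementary convex combinations of `p` and `q +
  -- d`; the two strict inequalities are multiplied.
  set t := d / (q + d - p) with ht
  have ht0 : 0 < t := div_pos hd hL
  have ht1 : t < 1 := (div_lt_one hL).2 (by linarith)
  have htL : t * (q + d - p) = d := div_mul_cancel₀ _ hL.ne'
  have hp := hf.pos p
  have hqd := hf.pos (q + d)
  have h1 := hf.2.2 (q + d) (mem_univ _) p (mem_univ _) (by linarith) t ht0 ht1
  have h2 := hf.2.2 p (mem_univ _) (q + d) (mem_univ _) (by linarith) t ht0 ht1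
  rw [show t • (q + d) + (1 - t) • p = p + d by simp only [smul_eq_mul]; linarith] at h1
  rw [show t • p + (1 - t) • (q + d) = q by simp only [smul_eq_mul]; linarith] at h2
  have key : f p * f (q + d) =
      (f (q + d) ^ t * f p ^ (1 - t)) * (f p ^ t * f (q + d) ^ (1 - t)) := by
    have e (x : ℝ) (hx : 0 < x) : x ^ t * x ^ (1 - t) = x := by
      rw [← Real.rpow_add hx]; simp
    calc f p * f (q + d) = (f p ^ t * f p ^ (1 - t)) * (f (q + d) ^ t * f (q + d) ^ (1 - t)) := by
          rw [e _ hp, e _ hqd]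
      _ = _ := by ring
  rw [key]
  exact mul_lt_mul'' h1 h2 (by positivity) (by positivity)

/-- A continuous strictly midpoint-concave function is strictly concave. -/
theorem strictConcaveOn_univ_of_midpoint {φ : ℝ → ℝ} (hφ : Continuous φ)
    (hmid : ∀ c d, 0 < d → φ (c - d) + φ (c + d) < 2 * φ c) : StrictConcaveOn ℝ univ φ := by
  refine strictConcaveOn_of_slope_strict_anti_adjacent convex_univ ?_
  intro a b c _ _ hab hbc
  set m := (φ c - φ a) / (c - a) with hm
  have hac : 0 < c - a := by linarith
  have hmc : m * (c - a) = φ c - φ a := div_mul_cancel₀ _ hac.ne'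
  -- Subtracting the chord over `[a, c]` preserves the midpoint inequality, which rules out an
  -- interior minimum; so `ψ` is positive inside.
  set ψ : ℝ → ℝ := fun x => φ x - φ a - m * (x - a) with hψ
  have hψc : Continuous ψ := by fun_prop
  obtain ⟨z, hz, hzmin⟩ := isCompact_Icc.exists_isMinOn (nonempty_Icc.2 (hab.trans hbc).le)
    hψc.continuousOn
  have hψa : ψ a = 0 := by simp [hψ]
  have hψc0 : ψ c = 0 := by simp only [hψ]; linarith
  have interior (x : ℝ) (hx : x ∈ Ioo a c) : ψ z < ψ x := by
    set d := min (x - a) (c - x)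
    have hd : 0 < d := lt_min (by linarith [hx.1]) (by linarith [hx.2])
    have hd1 : d ≤ x - a := min_le_left _ _
    have hd2 : d ≤ c - x := min_le_right _ _
    have h1 := isMinOn_iff.1 hzmin (x - d) ⟨by linarith, by linarith [hx.2]⟩
    have h2 := isMinOn_iff.1 hzmin (x + d) ⟨by linarith [hx.1], by linarith⟩
    have h3 := hmid x d hd
    simp only [hψ] at h1 h2 ⊢
    linarith
  have hz0 : ψ z = 0 := by
    rcases eq_or_lt_of_le hz.1 with h | h
    · rw [← h, hψa]
    rcases eq_or_lt_of_le hz.2 with h' | h'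
    · rw [h', hψc0]
    exact absurd (interior z ⟨h, h'⟩) (lt_irrefl _)
  have hb := interior b ⟨hab, hbc⟩
  rw [hz0] at hb
  simp only [hψ] at hb
  rw [div_lt_div_iff₀ (by linarith) (by linarith)]
  have hb' : m * (b - a) < φ b - φ a := by linarith
  have hb'' : φ c - φ b < m * (c - b) := by linarith
  nlinarith [mul_lt_mul_of_pos_right hb'' (sub_pos.2 hab), mul_lt_mul_of_pos_right hb' (sub_pos.2 hbc)]

/-! ### The strict composition inequality -/

/-- The strict form of the continuous Cauchy-Binet (Andréief) inequality for `2 × 2` minors. -/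
theorem integral_mul_integral_lt {A B C D : ℝ → ℝ}
    (hAC : Integrable fun x => A x * C x) (hBD : Integrable fun x => B x * D x)
    (hBC : Integrable fun x => B x * C x) (hAD : Integrable fun x => A x * D x)
    (h1 : ∀ x y, x < y → A y * B x < A x * B y) (h2 : ∀ x y, x < y → C y * D x < C x * D y) :
    (∫ x, B x * C x) * ∫ x, A x * D x < (∫ x, A x * C x) * ∫ x, B x * D x := by
  have i1 := hAC.mul_prod hBD
  have i2 := hAD.mul_prod hBC
  have i3 := hBC.mul_prod hAD
  have i4 := hBD.mul_prod hAC
  -- The product of the two minors is positive off the diagonal, and its integral is twice the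
  -- difference of the two sides.
  set F : ℝ × ℝ → ℝ := fun z =>
    (A z.1 * B z.2 - A z.2 * B z.1) * (C z.1 * D z.2 - C z.2 * D z.1) with hF
  have hFe : F = (fun z => A z.1 * C z.1 * (B z.2 * D z.2))
      - (fun z => A z.1 * D z.1 * (B z.2 * C z.2)) - (fun z => B z.1 * C z.1 * (A z.2 * D z.2))
      + fun z => B z.1 * D z.1 * (A z.2 * C z.2) := by
    funext z; simp only [hF, Pi.add_apply, Pi.sub_apply]; ring
  have hFi : Integrable F (volume.prod volume) := by
    rw [hFe]; exact ((i1.sub i2).sub i3).add i4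
  have hpos (z : ℝ × ℝ) (hz : z.1 < z.2) : 0 < F z :=
    mul_pos (by linarith [h1 _ _ hz]) (by linarith [h2 _ _ hz])
  have hF0 : 0 ≤ F := by
    intro z
    rcases lt_trichotomy z.1 z.2 with h | h | h
    · exact (hpos z h).le
    · simp [hF, h]
    · exact mul_nonneg_of_nonpos_of_nonpos (by linarith [h1 _ _ h]) (by linarith [h2 _ _ h])
  have hint : 0 < ∫ z, F z ∂(volume.prod volume) := by
    rw [integral_pos_iff_support_of_nonneg hF0 hFi]
    have hopen : IsOpen {z : ℝ × ℝ | z.1 < z.2} := isOpen_lt continuous_fst continuous_snd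
    exact (hopen.measure_pos _ ⟨(0, 1), by simp⟩).trans_le
      (measure_mono fun z hz => (hpos z hz).ne')
  rw [hFe, integral_add' ((i1.sub i2).sub i3) i4, integral_sub' (i1.sub i2) i3, integral_sub' i1 i2,
    integral_prod_mul (fun x => A x * C x) fun x => B x * D x,
    integral_prod_mul (fun x => A x * D x) fun x => B x * C x,
    integral_prod_mul (fun x => B x * C x) fun x => A x * D x,
    integral_prod_mul (fun x => B x * D x) fun x => A x * C x] at hint
  linarith

/-! ### Upper tails of densities -/

/-- A continuous, everywhere positive probability density on the line. -/
structure IsPosDensity (f : ℝ → ℝ) : Prop where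
  continuous : Continuous f
  pos : ∀ x, 0 < f x
  integrable : Integrable f
  integral_eq_one : ∫ x, f x = 1

/-- The mass that the density `f` gives to `(y, ∞)`. -/
noncomputable def upperTail (f : ℝ → ℝ) (y : ℝ) : ℝ := ∫ x in Ioi y, f x

section UpperTail

variable {f : ℝ → ℝ}

theorem upperTail_eq_integral_shift (f : ℝ → ℝ) (y : ℝ) :
    upperTail f y = ∫ x in Ioi 0, f (x + y) := by
  have h := (measurePreserving_add_right (volume : Measure ℝ) y).setIntegral_preimage_emb
    (measurableEmbedding_addRight y) f (Ioi y)
  rw [upperTail, ← h]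
  simp

theorem IsPosDensity.upperTail_antitone (hf : IsPosDensity f) : Antitone (upperTail f) :=
  fun _ _ hab => setIntegral_mono_set hf.integrable.integrableOn
    (Eventually.of_forall fun x => (hf.pos x).le) (Ioi_subset_Ioi hab).eventuallyLE

theorem IsPosDensity.upperTail_pos (hf : IsPosDensity f) (y : ℝ) : 0 < upperTail f y := by
  rw [upperTail, setIntegral_pos_iff_support_of_nonneg_ae
    (Eventually.of_forall fun x => (hf.pos x).le) hf.integrable.integrableOn]
  rw [Function.support_eq_univ fun x => (hf.pos x).ne', univ_inter]
  simp

theorem IsPosDensity.upperTail_le_one (hf : IsPosDensity f) (y : ℝ) : upperTail f y ≤ 1 := by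
  rw [← hf.integral_eq_one]
  exact setIntegral_le_integral hf.integrable (Eventually.of_forall fun x => (hf.pos x).le)

theorem IsPosDensity.norm_upperTail_le_one (hf : IsPosDensity f) (y : ℝ) :
    ‖upperTail f y‖ ≤ 1 := by
  rw [Real.norm_of_nonneg (hf.upperTail_pos y).le]
  exact hf.upperTail_le_one y

theorem IsPosDensity.hasDerivAt_upperTail (hf : IsPosDensity f) (y : ℝ) :
    HasDerivAt (upperTail f) (-f y) y := by
  have h : upperTail f = fun z => upperTail f 0 - ∫ x in (0 : ℝ)..z, f x := by
    funext z
    rw [← intervalIntegral.integral_Ioi_sub_Ioi' hf.integrable.integrableOn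
      hf.integrable.integrableOn]
    simp [upperTail]
  rw [h]
  exact (intervalIntegral.integral_hasDerivAt_right (hf.continuous.intervalIntegrable _ _)
    (hf.continuous.stronglyMeasurableAtFilter _ _) hf.continuous.continuousAt).const_sub _

theorem IsPosDensity.continuous_upperTail (hf : IsPosDensity f) : Continuous (upperTail f) :=
  continuous_iff_continuousAt.2 fun y => (hf.hasDerivAt_upperTail y).continuousAt

/-- The hazard rate `f / upperTail f` is strictly increasing: for `a < b`, integrate `f a * f (x +
b) < f b * f (x + a)` over `x > 0`. -/
theorem IsPosDensity.strictLogConcaveOn_upperTail (hf : IsPosDensity f)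
    (hlc : StrictLogConcaveOn univ f) : StrictLogConcaveOn univ (upperTail f) := by
  refine strictLogConcaveOn_of_strictConcaveOn_log (fun x _ => hf.upperTail_pos x) ?_
  refine StrictAnti.strictConcaveOn_univ_of_deriv
    (hf.continuous_upperTail.log fun y => (hf.upperTail_pos y).ne') ?_
  have hderiv : deriv (fun x => Real.log (upperTail f x)) = fun x => -f x / upperTail f x := by
    funext x
    exact ((hf.hasDerivAt_upperTail x).log (hf.upperTail_pos x).ne').deriv
  rw [hderiv]
  intro a b hab
  simp only
  rw [div_lt_div_iff₀ (hf.upperTail_pos b) (hf.upperTail_pos a)]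
  have ia : IntegrableOn (fun x => f b * f (x + a)) (Ioi 0) :=
    ((hf.integrable.comp_add_right a).const_mul _).integrableOn
  have ib : IntegrableOn (fun x => f a * f (x + b)) (Ioi 0) :=
    ((hf.integrable.comp_add_right b).const_mul _).integrableOn
  have hlt (x : ℝ) (hx : x ∈ Ioi 0) : 0 < f b * f (x + a) - f a * f (x + b) := by
    have := hlc.mul_lt_mul hab hx
    rw [add_comm b, add_comm a] at this
    linarith
  have h : 0 < ∫ x in Ioi 0, (f b * f (x + a) - f a * f (x + b)) := by
    rw [setIntegral_pos_iff_support_of_nonneg_ae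
      ((ae_restrict_iff' measurableSet_Ioi).2 (Eventually.of_forall fun x hx => (hlt x hx).le))
      (ia.sub ib)]
    refine lt_of_lt_of_le ?_ (measure_mono fun x hx => ⟨(hlt x hx).ne', hx⟩)
    simp
  rw [integral_sub ia ib, integral_const_mul, integral_const_mul, ← upperTail_eq_integral_shift,
    ← upperTail_eq_integral_shift] at h
  linarith

end UpperTail

/-! ### The probability that one shifted variable exceeds another -/

/-- The probability that `X + d > Y` for independent `X`, `Y` with densities `f`, `g`. -/
noncomputable def exceedProb (f g : ℝ → ℝ) (d : ℝ) : ℝ := ∫ y, upperTail f (y - d) * g y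

section ExceedProb

variable {f g : ℝ → ℝ}

theorem IsPosDensity.integrable_upperTail_mul (hf : IsPosDensity f) (hg : Integrable g) (d : ℝ) :
    Integrable fun y => upperTail f (y - d) * g y :=
  hg.bdd_mul (hf.continuous_upperTail.comp (by fun_prop)).aestronglyMeasurable
    (Eventually.of_forall fun _ => hf.norm_upperTail_le_one _)

theorem exceedProb_pos (hf : IsPosDensity f) (hg : IsPosDensity g) (d : ℝ) :
    0 < exceedProb f g d := by
  have hpos (y : ℝ) : 0 < upperTail f (y - d) * g y := mul_pos (hf.upperTail_pos _) (hg.pos y)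
  rw [exceedProb, integral_pos_iff_support_of_nonneg (fun y => (hpos y).le)
    (hf.integrable_upperTail_mul hg.integrable d), Function.support_eq_univ fun y => (hpos y).ne']
  simp

theorem exceedProb_le_one (hf : IsPosDensity f) (hg : IsPosDensity g) (d : ℝ) :
    exceedProb f g d ≤ 1 := by
  rw [← hg.integral_eq_one]
  exact integral_mono (hf.integrable_upperTail_mul hg.integrable d) hg.integrable fun y =>
    mul_le_of_le_one_left (hg.pos y).le (hf.upperTail_le_one _)

theorem exceedProb_monotone (hf : IsPosDensity f) (hg : IsPosDensity g) :
    Monotone (exceedProb f g) := fun a b hab =>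
  integral_mono (hf.integrable_upperTail_mul hg.integrable a)
    (hf.integrable_upperTail_mul hg.integrable b) fun y =>
      mul_le_mul_of_nonneg_right (hf.upperTail_antitone (by linarith)) (hg.pos y).le

theorem norm_upperTail_mul_le (hf : IsPosDensity f) (hg : IsPosDensity g) (d y : ℝ) :
    ‖upperTail f (y - d) * g y‖ ≤ g y := by
  rw [norm_mul, Real.norm_of_nonneg (hg.pos y).le]
  exact mul_le_of_le_one_left (hg.pos y).le (hf.norm_upperTail_le_one _)

theorem continuous_exceedProb (hf : IsPosDensity f) (hg : IsPosDensity g) :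
    Continuous (exceedProb f g) := by
  refine continuous_of_dominated (bound := g)
    (fun d => (hf.integrable_upperTail_mul hg.integrable d).aestronglyMeasurable)
    (fun d => Eventually.of_forall fun y => norm_upperTail_mul_le hf hg d y) hg.integrable
    (Eventually.of_forall fun y => ?_)
  exact (hf.continuous_upperTail.comp (by fun_prop)).mul continuous_const

theorem tendsto_exceedProb_atBot (hf : IsPosDensity f) (hg : IsPosDensity g) :
    Tendsto (exceedProb f g) atBot (𝓝 0) := by
  have h : Tendsto (exceedProb f g) atBot (𝓝 (∫ _ : ℝ, (0 : ℝ))) := by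
    refine tendsto_integral_filter_of_dominated_convergence g
      (Eventually.of_forall fun d =>
        (hf.integrable_upperTail_mul hg.integrable d).aestronglyMeasurable)
      (Eventually.of_forall fun d => Eventually.of_forall fun y =>
        norm_upperTail_mul_le hf hg d y) hg.integrable
      (Eventually.of_forall fun y => ?_)
    have ht : Tendsto (fun d : ℝ => y - d) atBot atTop := by
      simpa [sub_eq_add_neg] using tendsto_atTop_add_const_left atBot y tendsto_neg_atBot_atTop
    have h0 : Tendsto (fun d : ℝ => upperTail f (y - d)) atBot (𝓝 0) :=
      tendsto_integral_Ioi_zero ht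
    simpa using h0.mul_const (g y)
  simpa using h

/-- The midpoint inequality at `c` with step `d` is a `2 × 2` minor: pairing the tails shifted by
`c` and `c + d` with `g` and its shift by `d` produces the values at `c` (twice), `c + d` and `c -
d`. -/
theorem strictLogConcaveOn_exceedProb (hf : IsPosDensity f) (hg : IsPosDensity g)
    (hlf : StrictLogConcaveOn univ f) (hlg : StrictLogConcaveOn univ g) :
    StrictLogConcaveOn univ (exceedProb f g) := by
  refine strictLogConcaveOn_of_strictConcaveOn_log (fun d _ => exceedProb_pos hf hg d) ?_
  refine strictConcaveOn_univ_of_midpoint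
    ((continuous_exceedProb hf hg).log fun d => (exceedProb_pos hf hg d).ne') fun c d hd => ?_
  have hlt := hf.strictLogConcaveOn_upperTail hlf
  have hgd := hg.integrable.comp_sub_right d
  have key := integral_mul_integral_lt
    (A := fun y => upperTail f (y - c)) (B := fun y => upperTail f (y - (c + d)))
    (C := g) (D := fun y => g (y - d))
    (hf.integrable_upperTail_mul hg.integrable c) (hf.integrable_upperTail_mul hgd (c + d))
    (hf.integrable_upperTail_mul hg.integrable (c + d)) (hf.integrable_upperTail_mul hgd c)
    (fun x y hxy => by
      have := hlt.mul_lt_mul (show x - (c + d) < y - (c + d) by linarith) hd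
      rw [show y - (c + d) + d = y - c by ring, show x - (c + d) + d = x - c by ring] at this
      linarith)
    (fun x y hxy => by
      have := hlg.mul_lt_mul (show x - d < y - d by linarith) hd
      rw [show y - d + d = y by ring, show x - d + d = x by ring] at this
      linarith)
  have shift (a : ℝ) : ∫ y, upperTail f (y - (a + d)) * g (y - d) = exceedProb f g a := by
    rw [exceedProb, ← integral_sub_right_eq_self (fun y => upperTail f (y - a) * g y) d]
    refine integral_congr_ae (Eventually.of_forall fun y => ?_)
    simp only
    rw [show y - (a + d) = y - d - a by ring]
  have hcd := shift (c - d)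
  rw [show c - d + d = c by ring] at hcd
  rw [shift, hcd] at key
  have hp := exceedProb_pos hf hg
  have h := Real.log_lt_log (mul_pos (hp (c + d)) (hp (c - d))) key
  rw [Real.log_mul (hp _).ne' (hp _).ne', show (∫ x, upperTail f (x - c) * g x) =
    exceedProb f g c from rfl, Real.log_mul (hp _).ne' (hp _).ne'] at h
  linarith

end ExceedProb


/-! ### Directions along which the edges of a graph increase -/

/-- If `b` cannot be reached from `a` along `r`, some nonzero vector of the parameter space is weakly
decreasing along every edge of `r`. -/
theorem exists_direction_of_not_reflTransGen {k : ℕ} {r : Fin (k + 1) → Fin (k + 1) → Prop}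
    {a b : Fin (k + 1)} (h : ¬ Relation.ReflTransGen r a b) :
    ∃ v ∈ paramSpace k, v ≠ 0 ∧ ∀ i j, r i j → v j ≤ v i := by
  classical
  -- No edge leaves the set reachable from `a`, so the indicator of its complement cannot increase
  -- along an edge.
  let u : Fin (k + 1) → ℝ := fun i => if Relation.ReflTransGen r a i then 0 else 1
  have ua : u a = 0 := if_pos .refl
  have ub : u b = 1 := if_neg h
  -- Subtracting a constant normalizes the last coordinate; the result is nonzero because `u a ≠ u
  -- b`.
  refine ⟨fun i => u i - u (Fin.last k), by simp [paramSpace], fun hv => ?_, fun i j hij => ?_⟩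
  · have ha := congrFun hv a
    have hb := congrFun hv b
    simp only [Pi.zero_apply] at ha hb
    linarith
  · have : u j ≤ u i := by
      simp only [u]
      by_cases hi : Relation.ReflTransGen r a i
      · rw [if_pos hi, if_pos (hi.tail hij)]
      · rw [if_neg hi]
        split_ifs <;> norm_num
    linarith

/-! ### The composite likelihood -/

theorem convex_paramSpace (k : ℕ) : Convex ℝ (paramSpace k) := by
  intro x hx y hy a b _ _ _
  simp only [paramSpace, mem_ofPred_eq] at *
  simp [hx, hy]

theorem isClosed_paramSpace (k : ℕ) : IsClosed (paramSpace k) :=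
  isClosed_eq (continuous_apply _) continuous_const

section Likelihood

variable {m n : ℕ} (M : RUM m) (G : Breaking m) (W : CMLWeight m) (P : Profile m n)

theorem RUM.isPosDensity (i : Fin m) : IsPosDensity (M.pdf i) :=
  ⟨M.continuous_pdf i, M.pdf_pos i, M.integrable_pdf i, M.integral_pdf i⟩

/-- Translate `x` by `θ i` and `y` by `θ j`. -/
theorem RUM.pairProb_eq (i j : Fin m) (θ : Fin m → ℝ) :
    M.pairProb i j θ = exceedProb (M.pdf i) (M.pdf j) (θ i - θ j) := by
  have inner (y : ℝ) : ∫ x in Ioi y, M.pdf i (x - θ i) * M.pdf j (y - θ j) =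
      upperTail (M.pdf i) (y - θ j - (θ i - θ j)) * M.pdf j (y - θ j) := by
    rw [integral_mul_const]
    congr 1
    have h := (measurePreserving_sub_right (volume : Measure ℝ) (θ i)).setIntegral_preimage_emb
      (MeasurableEquiv.subRight (θ i)).measurableEmbedding (M.pdf i) (Ioi (y - θ i))
    rw [sub_sub_sub_cancel_right, upperTail, ← h]
    simp
  simp_rw [RUM.pairProb, inner]
  exact integral_sub_right_eq_self
    (fun y => upperTail (M.pdf i) (y - (θ i - θ j)) * M.pdf j y) (θ j)

theorem RUM.pairProb_pos (i j : Fin m) (θ : Fin m → ℝ) : 0 < M.pairProb i j θ := by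
  rw [M.pairProb_eq]
  exact exceedProb_pos (M.isPosDensity i) (M.isPosDensity j) _

theorem RUM.pairProb_le_one (i j : Fin m) (θ : Fin m → ℝ) : M.pairProb i j θ ≤ 1 := by
  rw [M.pairProb_eq]
  exact exceedProb_le_one (M.isPosDensity i) (M.isPosDensity j) _

theorem RUM.continuous_pairProb (i j : Fin m) : Continuous (M.pairProb i j) := by
  rw [show M.pairProb i j = _ from funext (M.pairProb_eq i j)]
  exact (continuous_exceedProb (M.isPosDensity i) (M.isPosDensity j)).comp (by fun_prop)

theorem kappa_nonneg (a b : Fin m) : 0 ≤ kappa G P a b := by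
  refine div_nonneg (Finset.sum_nonneg fun t _ => ?_) (Nat.cast_nonneg n)
  unfold Breaking.comparison
  split_ifs with h
  · exact G.nonneg _ _ h
  · exact le_rfl

theorem exponent_nonneg {i j : Fin m} (hij : i ≠ j) : 0 ≤ kappa G P i j * W.weight i j :=
  mul_nonneg (kappa_nonneg G P i j) (W.nonneg i j hij)

theorem weightedGraph_apply (i j : Fin m) :
    weightedGraph G W P i j = kappa G P i j * W.weight i j :=
  mul_comm _ _

theorem exponent_eq_zero_of_not_edge {i j : Fin m} (hij : i ≠ j)
    (h : ¬ 0 < weightedGraph G W P i j) : kappa G P i j * W.weight i j = 0 :=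
  le_antisymm (by simpa [weightedGraph_apply] using h) (exponent_nonneg G W P hij)

theorem compositeLikelihood_pos (θ : Fin m → ℝ) : 0 < compositeLikelihood M G W P θ :=
  Finset.prod_pos fun e _ => Real.rpow_pos_of_pos (M.pairProb_pos e.1 e.2 θ) _

theorem continuous_compositeLikelihood : Continuous (compositeLikelihood M G W P) :=
  continuous_finsetProd _ fun e _ => (M.continuous_pairProb e.1 e.2).rpow_const fun θ =>
    Or.inl (M.pairProb_pos e.1 e.2 θ).ne'

theorem compositeLikelihood_le_factor {i j : Fin m} (hij : i ≠ j) (θ : Fin m → ℝ) :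
    compositeLikelihood M G W P θ ≤ M.pairProb i j θ ^ (kappa G P i j * W.weight i j) := by
  have hmem : (i, j) ∈ (Finset.univ : Finset (Fin m)).offDiag := by simp [hij]
  rw [compositeLikelihood, ← Finset.mul_prod_erase _ _ hmem]
  refine mul_le_of_le_one_right (Real.rpow_nonneg (M.pairProb_pos _ _ _).le _)
    (Finset.prod_le_one (fun e _ => Real.rpow_nonneg (M.pairProb_pos _ _ _).le _) fun e he => ?_)
  have he' : e.1 ≠ e.2 := (Finset.mem_offDiag.1 (Finset.mem_of_mem_erase he)).2.2
  exact Real.rpow_le_one (M.pairProb_pos _ _ _).le (M.pairProb_le_one _ _ _)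
    (exponent_nonneg G W P he')

/-- The composite likelihood is monotone in the parameter differences along the edges. -/
theorem compositeLikelihood_le_of_edges {x y : Fin m → ℝ}
    (h : ∀ i j, 0 < weightedGraph G W P i j → x i - x j ≤ y i - y j) :
    compositeLikelihood M G W P x ≤ compositeLikelihood M G W P y := by
  refine Finset.prod_le_prod (fun e _ => Real.rpow_nonneg (M.pairProb_pos _ _ _).le _) fun e he => ?_
  have hne : e.1 ≠ e.2 := (Finset.mem_offDiag.1 he).2.2
  by_cases hedge : 0 < weightedGraph G W P e.1 e.2
  · refine Real.rpow_le_rpow (M.pairProb_pos _ _ _).le ?_ (exponent_nonneg G W P hne)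
    rw [M.pairProb_eq, M.pairProb_eq]
    exact exceedProb_monotone (M.isPosDensity _) (M.isPosDensity _) (h _ _ hedge)
  · simp [exponent_eq_zero_of_not_edge G W P hne hedge]

theorem compositeLikelihood_eq_of_edges {x y : Fin m → ℝ}
    (h : ∀ i j, 0 < weightedGraph G W P i j → x i - x j = y i - y j) :
    compositeLikelihood M G W P x = compositeLikelihood M G W P y :=
  le_antisymm (compositeLikelihood_le_of_edges M G W P fun i j hij => (h i j hij).le)
    (compositeLikelihood_le_of_edges M G W P fun i j hij => (h i j hij).ge)

/-- On a superlevel set the parameter differences along directed paths are bounded below. -/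
theorem exists_lower_bound_of_path {i j : Fin m} {c : ℝ} (hc : 0 < c)
    (h : Relation.ReflTransGen (fun a b => 0 < weightedGraph G W P a b) i j) :
    ∃ B, ∀ θ, c ≤ compositeLikelihood M G W P θ → B ≤ θ i - θ j := by
  induction h with
  | refl => exact ⟨0, fun θ _ => by simp⟩
  | @tail a b _ hab ih =>
    obtain ⟨B, hB⟩ := ih
    rcases eq_or_ne a b with rfl | hne
    · exact ⟨B, hB⟩
    rw [weightedGraph_apply] at hab
    have ht := (tendsto_exceedProb_atBot (M.isPosDensity a) (M.isPosDensity b)).rpow_const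
      (p := kappa G P a b * W.weight a b) (Or.inr hab.le)
    rw [Real.zero_rpow hab.ne'] at ht
    -- A difference at most `N` would make the factor of this edge, hence the whole likelihood,
    -- smaller than `c`.
    obtain ⟨N, hN⟩ := eventually_atBot.1 (ht.eventually_lt_const hc)
    refine ⟨B + N, fun θ hθ => ?_⟩
    have h1 : N ≤ θ a - θ b := by
      by_contra hlt
      have h2 := hN _ (not_le.1 hlt).le
      rw [← M.pairProb_eq] at h2
      exact absurd (hθ.trans (compositeLikelihood_le_factor M G W P hne θ)) (not_le.2 h2)
    linarith [hB θ hθ]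

theorem strictLogConcaveOn_pairProb_lt (hlc : ∀ i, StrictLogConcaveOn univ (M.pdf i))
    {x y : Fin m → ℝ} {i j : Fin m} (hxy : x i - x j ≠ y i - y j) {c : ℝ} (hc : 0 < c)
    (hc1 : c < 1) :
    M.pairProb i j x ^ c * M.pairProb i j y ^ (1 - c) < M.pairProb i j (c • x + (1 - c) • y) := by
  simp only [M.pairProb_eq]
  convert (strictLogConcaveOn_exceedProb (M.isPosDensity i) (M.isPosDensity j) (hlc i)
    (hlc j)).2.2 _ (mem_univ _) _ (mem_univ _) hxy c hc hc1 using 2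
  simp only [Pi.add_apply, Pi.smul_apply, smul_eq_mul]
  ring

theorem strictLogConcaveOn_pairProb_le (hlc : ∀ i, StrictLogConcaveOn univ (M.pdf i))
    (x y : Fin m → ℝ) (i j : Fin m) {c : ℝ} (hc : 0 < c) (hc1 : c < 1) :
    M.pairProb i j x ^ c * M.pairProb i j y ^ (1 - c) ≤ M.pairProb i j (c • x + (1 - c) • y) := by
  simp only [M.pairProb_eq]
  convert (strictLogConcaveOn_exceedProb (M.isPosDensity i) (M.isPosDensity j) (hlc i)
    (hlc j)).le (x i - x j) (y i - y j) hc hc1 using 2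
  simp only [Pi.add_apply, Pi.smul_apply, smul_eq_mul]
  ring

/-- The inequality holds weakly in every factor, and strictly in the factor of the given edge, whose
exponent is positive. -/
theorem compositeLikelihood_lt_of_edge (hlc : ∀ i, StrictLogConcaveOn univ (M.pdf i))
    {x y : Fin m → ℝ} {i j : Fin m} (hij : i ≠ j) (hedge : 0 < weightedGraph G W P i j)
    (hxy : x i - x j ≠ y i - y j) {c : ℝ} (hc : 0 < c) (hc1 : c < 1) :
    compositeLikelihood M G W P x ^ c * compositeLikelihood M G W P y ^ (1 - c) <
      compositeLikelihood M G W P (c • x + (1 - c) • y) := by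
  have hp (e : Fin m × Fin m) (θ : Fin m → ℝ) := M.pairProb_pos e.1 e.2 θ
  have combine (e : Fin m × Fin m) (r : ℝ) :
      (M.pairProb e.1 e.2 x ^ r) ^ c * (M.pairProb e.1 e.2 y ^ r) ^ (1 - c) =
        (M.pairProb e.1 e.2 x ^ c * M.pairProb e.1 e.2 y ^ (1 - c)) ^ r := by
    rw [Real.mul_rpow (Real.rpow_nonneg (hp e x).le _) (Real.rpow_nonneg (hp e y).le _),
      ← Real.rpow_mul (hp e x).le, ← Real.rpow_mul (hp e x).le, ← Real.rpow_mul (hp e y).le,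
      ← Real.rpow_mul (hp e y).le, mul_comm r, mul_comm r]
  have hbase (e : Fin m × Fin m) :
      0 < M.pairProb e.1 e.2 x ^ c * M.pairProb e.1 e.2 y ^ (1 - c) :=
    mul_pos (Real.rpow_pos_of_pos (hp e x) _) (Real.rpow_pos_of_pos (hp e y) _)
  simp only [compositeLikelihood]
  rw [← Real.finsetProd_rpow _ _ fun e _ => Real.rpow_nonneg (hp e x).le _,
    ← Real.finsetProd_rpow _ _ fun e _ => Real.rpow_nonneg (hp e y).le _,
    ← Finset.prod_mul_distrib]
  simp only [combine]
  refine Finset.prod_lt_prod (fun e _ => Real.rpow_pos_of_pos (hbase e) _) (fun e he => ?_)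
    ⟨(i, j), by simp [hij], ?_⟩
  · exact Real.rpow_le_rpow (hbase e).le (strictLogConcaveOn_pairProb_le M hlc x y _ _ hc hc1)
      (exponent_nonneg G W P (Finset.mem_offDiag.1 he).2.2)
  · rw [weightedGraph_apply] at hedge
    exact Real.rpow_lt_rpow (hbase (i, j)).le (strictLogConcaveOn_pairProb_lt M hlc hxy hc hc1) hedge

end Likelihood

/-! ### The two equivalences -/

section Main

variable {k n : ℕ} (M : RUM (k + 1)) (G : Breaking (k + 1)) (W : CMLWeight (k + 1))
  (P : Profile (k + 1) n)

theorem strictLogConcaveOn_of_weaklyConnected (hlc : ∀ i, StrictLogConcaveOn univ (M.pdf i))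
    (h : (weightedGraph G W P).WeaklyConnected) :
    StrictLogConcaveOn (paramSpace k) (compositeLikelihood M G W P) := by
  refine ⟨convex_paramSpace k, fun θ _ => compositeLikelihood_pos M G W P θ,
    fun x hx y hy hxy c hc hc1 => ?_⟩
  by_contra hlt
  have hedge (i j : Fin (k + 1)) (hij : i ≠ j) (he : 0 < weightedGraph G W P i j) :
      x i - x j = y i - y j := by
    by_contra hne
    exact hlt (compositeLikelihood_lt_of_edge M G W P hlc hij he hne hc hc1)
  refine hxy (funext fun i => ?_)
  have hreach := h.preconnected i (Fin.last k)
  rw [SimpleGraph.reachable_iff_reflTransGen] at hreach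
  have hdiff : x i - x (Fin.last k) = y i - y (Fin.last k) := by
    generalize Fin.last k = l at hreach ⊢
    induction hreach with
    | refl => simp
    | tail _ hab ih =>
      obtain ⟨hne, he | he⟩ := (SimpleGraph.fromRel_adj _ _ _).1 hab
      · linarith [hedge _ _ hne he]
      · linarith [hedge _ _ hne.symm he]
  simp only [paramSpace, mem_ofPred_eq] at hx hy
  linarith

theorem weaklyConnected_of_strictLogConcaveOn
    (h : StrictLogConcaveOn (paramSpace k) (compositeLikelihood M G W P)) :
    (weightedGraph G W P).WeaklyConnected := by
  refine (SimpleGraph.connected_iff _).2 ⟨fun a b => ?_, inferInstance⟩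
  rw [SimpleGraph.reachable_iff_reflTransGen]
  by_contra hab
  obtain ⟨v, hv, hv0, hmono⟩ := exists_direction_of_not_reflTransGen hab
  have hconst (i j : Fin (k + 1)) (hij : 0 < weightedGraph G W P i j) : v i = v j := by
    rcases eq_or_ne i j with rfl | hne
    · rfl
    · exact le_antisymm (hmono j i ((SimpleGraph.fromRel_adj _ _ _).2 ⟨hne.symm, Or.inr hij⟩))
        (hmono i j ((SimpleGraph.fromRel_adj _ _ _).2 ⟨hne, Or.inl hij⟩))
  -- The likelihood takes one value at `0`, at `v` and at their midpoint, which contradicts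
  -- strictness.
  have hlt := h.2.2 v hv 0 rfl hv0 (1 / 2) (by norm_num) (by norm_num)
  have e1 : compositeLikelihood M G W P 0 = compositeLikelihood M G W P v :=
    compositeLikelihood_eq_of_edges M G W P fun i j hij => by simp [hconst i j hij]
  have e2 : compositeLikelihood M G W P ((1 / 2 : ℝ) • v + (1 - 1 / 2 : ℝ) • 0) =
      compositeLikelihood M G W P v :=
    compositeLikelihood_eq_of_edges M G W P fun i j hij => by simp [hconst i j hij]
  rw [e1, e2, ← Real.rpow_add (compositeLikelihood_pos M G W P v)] at hlt
  norm_num at hlt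

/-- Paths to the last vertex bound the coordinates below, paths from it bound them above, since its
own coordinate is `0`. -/
theorem isBounded_superlevel (h : (weightedGraph G W P).StronglyConnected) {c : ℝ} (hc : 0 < c) :
    Bornology.IsBounded (paramSpace k ∩ {θ | c ≤ compositeLikelihood M G W P θ}) := by
  choose lo hlo using fun i => exists_lower_bound_of_path M G W P hc (h i (Fin.last k))
  choose up hup using fun i => exists_lower_bound_of_path M G W P hc (h (Fin.last k) i)
  refine (Metric.isBounded_Icc lo (fun i => -up i)).subset ?_
  rintro θ ⟨hθ, hcθ⟩
  have hlast : θ (Fin.last k) = 0 := hθ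
  exact ⟨fun i => by linarith [hlo i θ hcθ], fun i => by linarith [hup i θ hcθ]⟩

theorem argmaxOn_nonempty_isBounded_of_stronglyConnected
    (h : (weightedGraph G W P).StronglyConnected) :
    (argmaxOn (paramSpace k) (compositeLikelihood M G W P)).Nonempty ∧
      Bornology.IsBounded (argmaxOn (paramSpace k) (compositeLikelihood M G W P)) := by
  have hcont := continuous_compositeLikelihood M G W P
  have h0 : (0 : Fin (k + 1) → ℝ) ∈ paramSpace k := rfl
  have hbdd := isBounded_superlevel M G W P h (compositeLikelihood_pos M G W P 0)
  refine ⟨?_, hbdd.subset fun θ hθ => ⟨hθ.1, isMaxOn_iff.1 hθ.2 0 h0⟩⟩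
  have hcompact := Metric.isCompact_of_isClosed_isBounded
    ((isClosed_paramSpace k).inter (isClosed_le continuous_const hcont)) hbdd
  obtain ⟨θ, hθ, hmax⟩ := hcompact.exists_isMaxOn ⟨0, h0, le_refl (compositeLikelihood M G W P 0)⟩ hcont.continuousOn
  refine ⟨θ, hθ.1, isMaxOn_iff.2 fun x hx => ?_⟩
  rcases le_total (compositeLikelihood M G W P 0) (compositeLikelihood M G W P x) with hle | hle
  · exact isMaxOn_iff.1 hmax x ⟨hx, hle⟩
  · exact hle.trans hθ.2

theorem stronglyConnected_of_argmaxOn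
    (hne : (argmaxOn (paramSpace k) (compositeLikelihood M G W P)).Nonempty)
    (hbdd : Bornology.IsBounded (argmaxOn (paramSpace k) (compositeLikelihood M G W P))) :
    (weightedGraph G W P).StronglyConnected := by
  intro a b
  by_contra hab
  obtain ⟨v, hv, hv0, hmono⟩ := exists_direction_of_not_reflTransGen hab
  obtain ⟨θ, hθ, hmax⟩ := hne
  obtain ⟨R, hR⟩ := isBounded_iff_forall_norm_le.1 hbdd
  have hv' : 0 < ‖v‖ := norm_pos_iff.2 hv0
  -- Chosen so that `‖θ + t • v‖ ≥ |R| + 1`, beyond the bound `R` on maximizers.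
  set t := (|R| + ‖θ‖ + 1) / ‖v‖ with ht
  have ht0 : 0 ≤ t := by positivity
  have hmem : θ + t • v ∈ argmaxOn (paramSpace k) (compositeLikelihood M G W P) := by
    refine ⟨?_, isMaxOn_iff.2 fun x hx => (isMaxOn_iff.1 hmax x hx).trans ?_⟩
    · simp only [paramSpace, mem_ofPred_eq] at hθ hv
      simp [paramSpace, hθ, hv]
    · refine compositeLikelihood_le_of_edges M G W P fun i j hij => ?_
      simp only [Pi.add_apply, Pi.smul_apply, smul_eq_mul]
      linarith [mul_le_mul_of_nonneg_left (hmono i j hij) ht0]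
  have h1 : t * ‖v‖ = |R| + ‖θ‖ + 1 := div_mul_cancel₀ _ hv'.ne'
  have h2 : ‖t • v‖ ≤ ‖θ + t • v‖ + ‖θ‖ := by
    simpa using norm_sub_le (θ + t • v) θ
  rw [norm_smul, Real.norm_of_nonneg ht0, h1] at h2
  linarith [hR _ hmem, le_abs_self R]

end Main

end RBCML

theorem mainTheorem8 (k n : ℕ) (hn : 0 < n) (M : RBCML.RUM (k + 1))
    (G : RBCML.Breaking (k + 1)) (W : RBCML.CMLWeight (k + 1)) (P : RBCML.Profile (k + 1) n) :
    ((∀ i, RBCML.StrictLogConcaveOn Set.univ (M.pdf i)) →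
      (RBCML.StrictLogConcaveOn (RBCML.paramSpace k) (RBCML.compositeLikelihood M G W P) ↔
        (RBCML.weightedGraph G W P).WeaklyConnected)) ∧
    (((RBCML.argmaxOn (RBCML.paramSpace k) (RBCML.compositeLikelihood M G W P)).Nonempty ∧
        Bornology.IsBounded
          (RBCML.argmaxOn (RBCML.paramSpace k) (RBCML.compositeLikelihood M G W P))) ↔
      (RBCML.weightedGraph G W P).StronglyConnected) :=
  ⟨fun hlc => ⟨RBCML.weaklyConnected_of_strictLogConcaveOn M G W P,
    RBCML.strictLogConcaveOn_of_weaklyConnected M G W P hlc⟩,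
   fun h => RBCML.stronglyConnected_of_argmaxOn M G W P h.1 h.2,
    RBCML.argmaxOn_nonempty_isBounded_of_stronglyConnected M G W P⟩
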